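/- A monotone cyclic Boolean circuit over input variables $x_1,\dots,x_N$ consists of gates $g_1,\dots,g_t$ ($t\ge 1$), where each $g_i$ is a fan-in-two AND gate or a fan-in-two OR gate whose two operands are arbitrary elements (not necessarily distinct) of $\{g_1,\dots,g_t\}\cup\{x_1,\dots,x_N,0,1\}$; cycles are allowed. On an input $x\in\{0,1\}^N$ the circuit is evaluated as follows: all gates have value $0$ at time $0$, and at each step $j\ge 1$ every gate is simultaneously updated by $g_i^{\,j}=g_i^{\,j-1}\vee(u^{j-1}\star_i v^{j-1})$, where $\star_i\in\{\wedge,\vee\}$ is the operation of $g_i$, and $u^{j-1},v^{j-1}$ are the values of its two operands after step $j-1$ (input variables and constants keep their values throughout). The circuit computes $f\colon\{0,1\}^N\to\{0,1\}$ if there is a $j_0$ such that $g_t^{\,j}(x)=f(x)$ for all inputs $x$ and all $j\ge j_0$. Let $3\text{-}\mathsf{clique}\colon\{0,1\}^{\binom n2}\to\{0,1\}$ be the function that evaluates to $1$ on an undirected $n$-vertex graph $G$, given by one input variable for each unordered pair of distinct vertices, if and only if $G$ contains a $3$-clique (a triangle). **Corollary.** There are a constant $c>0$ and an $n_0\in\mathbb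 N$ such that for every $n\ge n_0$, every monotone cyclic Boolean circuit that computes $3\text{-}\mathsf{clique}$ on $n$-vertex graphs contains at least $c\cdot n^3/(\log n)^4$ fan-in-two AND gates. -/

import Mathlib

namespace CyclicCircuit

/-- The two operations of a monotone construction: intersection (AND) and union (OR). -/
inductive SetOp where
  | inter : SetOp
  | union : SetOp

/-- The binary set operation denoted by a `SetOp`. -/
def SetOp.apply {Γ : Type*} : SetOp → Set Γ → Set Γ → Set Γ
  | .inter, X, Y => X ∩ Y
  | .union, X, Y => X ∪ Y

/-- A syntactic sequence `I_1, …, I_t` (`t ≥ 1`) over a family `B` of generators: the `i`-th entry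
applies the operation `op i` to two operands, each of which is either an entry of the sequence
(`Sum.inl`, with no restriction on its index, so that cycles are allowed) or a generator
(`Sum.inr`). -/
structure SyntacticSequence {Γ : Type*} (B : Set (Set Γ)) where
  /-- the length `t` -/
  len : ℕ
  len_pos : 0 < len
  op : Fin len → SetOp
  left : Fin len → Fin len ⊕ B
  right : Fin len → Fin len ⊕ B

namespace SyntacticSequence

variable {Γ : Type*} {B : Set (Set Γ)}

/-- The index of the last entry, which is the output. -/
def last (S : SyntacticSequence B) : Fin S.len :=
  ⟨S.len - 1, Nat.sub_lt S.len_pos Nat.one_pos⟩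

/-- The current set of an operand, when the entries currently have the sets `v`.
Generators are fixed. -/
def operand (S : SyntacticSequence B) (v : Fin S.len → Set Γ) : Fin S.len ⊕ B → Set Γ
  | .inl i => v i
  | .inr b => b.1

/-- The evaluation: all entries are empty at time `0`, and at each step all entries are
simultaneously enlarged by the result of their operation on the previous sets. -/
def stage (S : SyntacticSequence B) : ℕ → Fin S.len → Set Γ
  | 0, _ => ∅
  | j + 1, i => S.stage j i ∪
      (S.op i).apply (S.operand (S.stage j) (S.left i)) (S.operand (S.stage j) (S.right i))

/-- The sequence generates `A` if the set of its last entry is eventually equal to `A`. -/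
def Generates (S : SyntacticSequence B) (A : Set Γ) : Prop :=
  ∃ j : ℕ, ∀ j' : ℕ, j ≤ j' → S.stage j' S.last = A

/-- The number of intersection operations. -/
noncomputable def interCount (S : SyntacticSequence B) : ℕ :=
  {i : Fin S.len | S.op i = SetOp.inter}.ncard

end SyntacticSequence

/-- The generators of monotone Boolean circuits with input variables indexed by `V`: the sets
`{x | x i = 1}`, together with the two constants `∅` and `{0,1}^V`. -/
def monotoneGenerators (V : Type*) : Set (Set (V → Bool)) :=
  {X | ∃ i : V, X = {x | x i = true}} ∪ {∅, Set.univ}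

/-- Monotone cyclic Boolean circuits with input variables indexed by `V`; the gates are fan-in two
AND gates (intersections) and fan-in two OR gates (unions). -/
abbrev MonotoneCyclicCircuit (V : Type*) : Type _ :=
  SyntacticSequence (monotoneGenerators V)

/-- The circuit computes the Boolean function whose set of accepted inputs is
`{x | f x = 1}`. -/
def MonotoneCyclicCircuit.Computes {V : Type*} (C : MonotoneCyclicCircuit V)
    (f : (V → Bool) → Bool) : Prop :=
  SyntacticSequence.Generates C {x | f x = true}

/-- The number of fan-in two AND gates. -/
noncomputable def MonotoneCyclicCircuit.andCount {V : Type*} (C : MonotoneCyclicCircuit V) : ℕ :=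
  SyntacticSequence.interCount C

/-- The `n.choose 2` possible edges (unordered pairs of distinct vertices) on `n` vertices. -/
abbrev EdgeVar (n : ℕ) : Type := {e : Sym2 (Fin n) // ¬ e.IsDiag}

/-- The undirected graph on `n` vertices encoded by an input. -/
def inputGraph {n : ℕ} (x : EdgeVar n → Bool) : SimpleGraph (Fin n) :=
  SimpleGraph.fromEdgeSet {e | ∃ h : ¬ e.IsDiag, x ⟨e, h⟩ = true}

open Classical in
/-- The function `k`-clique on `n`-vertex graphs. -/
noncomputable def kClique (k n : ℕ) (x : EdgeVar n → Bool) : Bool :=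
  decide (∃ s : Finset (Fin n), (inputGraph x).IsNClique k s)

end CyclicCircuit

/-! Fusion argument. Rejected inputs are the cuts of two-colourings, accepted ones the triangles.
For a triangle `T` and a set `U` of colourings, let F be the family of sets `X` for which some edge
of `T` has all its splittings in `U` accepted by `X`. If F respects every AND gate, it contains the
limit set of the output (`limit_mem_of_mem`); but that set contains no cut, while `U` splits every
edge. So each `T` must be spoiled by some AND gate. `exists_large_closed` picks `U` so that an
operand either accepts all of `U` or is forced by fewer than `(2 * k) ^ 2` edges. A gate then spoils
`T` only if `T` is the union of two such edges, one per operand: fewer than `(2 * k) ^ 4` triangles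
per gate, with `k` of order `log n`. -/

namespace CyclicCircuit

/-! ### Two-colourings and forced edges -/

section Colorings

open Finset

variable {α : Type*}

/-- The colouring `χ` is constant on `e`. -/
def IsMono (χ : α → Bool) (e : Finset α) : Prop := ∀ x ∈ e, ∀ y ∈ e, χ x = χ y

variable [Fintype α] [DecidableEq α]

open Classical in
/-- The two-colourings that are constant on every member of `L`. -/
noncomputable def monoColorings (L : Finset (Finset α)) : Finset (α → Bool) :=
  univ.filter fun χ => ∀ e ∈ L, IsMono χ e

open Classical in
/-- The edges `e` such that every colouring in `U` that is not constant on `e` lies in `A`. -/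
noncomputable def forced (U A : Finset (α → Bool)) : Finset (Finset α) :=
  (powersetCard 2 univ).filter fun e => ∀ χ ∈ U, ¬ IsMono χ e → χ ∈ A

lemma mem_monoColorings {L : Finset (Finset α)} {χ : α → Bool} :
    χ ∈ monoColorings L ↔ ∀ e ∈ L, IsMono χ e := by
  simp [monoColorings]

lemma mem_forced {U A : Finset (α → Bool)} {e : Finset α} :
    e ∈ forced U A ↔ e.card = 2 ∧ ∀ χ ∈ U, ¬ IsMono χ e → χ ∈ A := by
  simp [forced]

/-- Requiring constancy on an edge with a new endpoint halves the number of colourings. -/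
lemma two_mul_card_monoColorings_insert_le {L : Finset (Finset α)} {X e : Finset α} {a b : α}
    (hL : ∀ e ∈ L, e ⊆ X) (ha : a ∈ e) (hb : b ∈ e) (hab : a ≠ b) (hbX : b ∉ X) :
    2 * (monoColorings (insert e L)).card ≤ (monoColorings L).card := by
  -- Flipping the colour of `b` breaks constancy on `e` but not on members of `L`, which avoid `b`.
  let g : (α → Bool) → (α → Bool) := fun χ => Function.update χ b (!χ b)
  have hg : Function.Injective g := by
    refine Function.LeftInverse.injective (g := g) fun χ => ?_
    simp [g]
  have hdisj : Disjoint (monoColorings (insert e L)) ((monoColorings (insert e L)).image g) := by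
    rw [Finset.disjoint_left]
    intro χ h1 h2
    obtain ⟨ψ, hψ, rfl⟩ := mem_image.1 h2
    have e1 := mem_monoColorings.1 h1 e (mem_insert_self _ _) a ha b hb
    have e2 := mem_monoColorings.1 hψ e (mem_insert_self _ _) a ha b hb
    simp [g, Function.update_of_ne hab, e2] at e1
  have hsub : monoColorings (insert e L) ∪ (monoColorings (insert e L)).image g
      ⊆ monoColorings L := by
    intro χ h
    rw [mem_monoColorings]
    intro f hf
    rcases mem_union.1 h with h | h
    · exact mem_monoColorings.1 h f (mem_insert_of_mem hf)
    · obtain ⟨ψ, hψ, rfl⟩ := mem_image.1 h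
      intro x hx y hy
      have hxb : x ≠ b := fun h => hbX (h ▸ hL f hf hx)
      have hyb : y ≠ b := fun h => hbX (h ▸ hL f hf hy)
      simpa [g, Function.update_of_ne hxb, Function.update_of_ne hyb] using
        mem_monoColorings.1 hψ f (mem_insert_of_mem hf) x hx y hy
  have := card_le_card hsub
  rw [card_union_of_disjoint hdisj, card_image_of_injective _ hg] at this
  omega

lemma card_monoColorings_empty :
    (monoColorings (∅ : Finset (Finset α))).card = 2 ^ Fintype.card α := by
  simp [monoColorings]

/-- Greedy choice: `2 * k` vertices span fewer edges than `H` has, so some edge leaves `X`; adding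
it halves the count and costs at most two vertices. -/
lemma exists_subset_card_monoColorings_le {H : Finset (Finset α)} (hH : ∀ e ∈ H, e.card = 2)
    (k : ℕ) (hk : (2 * k) ^ 2 ≤ H.card) :
    ∃ L ⊆ H, ∃ X : Finset α, X.card ≤ 2 * k ∧ (∀ e ∈ L, e ⊆ X) ∧
      (monoColorings L).card * 2 ^ k ≤ 2 ^ Fintype.card α := by
  induction k with
  | zero => exact ⟨∅, by simp, ∅, by simp, by simp, by simp [card_monoColorings_empty]⟩
  | succ k ih =>
    obtain ⟨L, hLH, X, hX, hLX, hc⟩ := ih (le_trans (by gcongr; omega) hk)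
    obtain ⟨e, heH, heX⟩ : ∃ e ∈ H, ¬ e ⊆ X := by
      by_contra! hall
      have h1 : H ⊆ powersetCard 2 X := fun e he => mem_powersetCard.2 ⟨hall e he, hH e he⟩
      have h2 := card_le_card h1
      rw [card_powersetCard] at h2
      have h3 : X.card.choose 2 ≤ X.card ^ 2 := Nat.choose_le_pow _ _
      have h4 : X.card ^ 2 ≤ (2 * k) ^ 2 := Nat.pow_le_pow_left hX 2
      nlinarith
    obtain ⟨b, hbe, hbX⟩ := not_subset.1 heX
    obtain ⟨a, hae, hab⟩ := exists_mem_ne (by rw [hH e heH]; norm_num) b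
    refine ⟨insert e L, insert_subset heH hLH, X ∪ e, ?_, ?_, ?_⟩
    · have := card_union_le X e
      rw [hH e heH] at this
      omega
    · intro f hf
      rcases mem_insert.1 hf with rfl | hf
      · exact subset_union_right
      · exact (hLX f hf).trans subset_union_left
    · have := two_mul_card_monoColorings_insert_le hLX hae hbe hab hbX
      calc _ = (2 * (monoColorings (insert e L)).card) * 2 ^ k := by ring
        _ ≤ (monoColorings L).card * 2 ^ k := by gcongr
        _ ≤ _ := hc

/-- Few two-colourings are constant on every edge of a graph with many edges. -/
lemma card_monoColorings_mul_le {H : Finset (Finset α)} (hH : ∀ e ∈ H, e.card = 2)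
    (k : ℕ) (hk : (2 * k) ^ 2 ≤ H.card) :
    (monoColorings H).card * 2 ^ k ≤ 2 ^ Fintype.card α := by
  obtain ⟨L, hLH, -, -, -, hc⟩ := exists_subset_card_monoColorings_le hH k hk
  refine le_trans ?_ hc
  gcongr
  exact fun χ hχ => mem_monoColorings.2 fun e he => mem_monoColorings.1 hχ e (hLH he)

/-- There is a large set of colourings in which every set of the family that is forced by many
edges is everything. -/
lemma exists_large_closed (𝒜 : Finset (Finset (α → Bool))) (k : ℕ) :
    ∃ U : Finset (α → Bool), Uᶜ.card * 2 ^ k ≤ 𝒜.card * 2 ^ Fintype.card α ∧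
      ∀ A ∈ 𝒜, U ⊆ A ∨ (forced U A).card < (2 * k) ^ 2 := by
  let good : Finset (Finset (Finset (α → Bool))) :=
    𝒜.powerset.filter fun J => (J.inf id)ᶜ.card * 2 ^ k ≤ J.card * 2 ^ Fintype.card α
  -- A violating `A` could join a maximal `J`: intersecting with `A` loses only colourings constant
  -- on all its forced edges, at most a `2 ^ (-k)` fraction.
  obtain ⟨J, hJ, hmax⟩ := good.exists_max_image card ⟨∅, by simp [good]⟩
  obtain ⟨hJA, hJc⟩ := mem_filter.1 hJ
  rw [mem_powerset] at hJA
  refine ⟨J.inf id, hJc.trans (by gcongr), fun A hA => ?_⟩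
  by_contra! hcon
  obtain ⟨hnot, hbig⟩ := hcon
  have hAJ : A ∉ J := fun h => hnot (Finset.inf_le (f := id) h)
  have hsub : J.inf id \ A ⊆ monoColorings (forced (J.inf id) A) := by
    intro χ hχ
    rw [mem_sdiff] at hχ
    refine mem_monoColorings.2 fun e he => ?_
    by_contra hm
    exact hχ.2 ((mem_forced.1 he).2 χ hχ.1 hm)
  have hmono := card_monoColorings_mul_le (fun e he => (mem_forced.1 he).1) k hbig
  have hcompl : ((insert A J).inf id)ᶜ ⊆ (J.inf id)ᶜ ∪ (J.inf id \ A) := by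
    intro χ hχ
    simp only [inf_insert, id_eq, mem_compl, inf_eq_inter, mem_inter, mem_union,
      mem_sdiff] at hχ ⊢
    tauto
  have hle := (card_le_card hcompl).trans (card_union_le _ _)
  have hle' := card_le_card hsub
  have : insert A J ∈ good := by
    refine mem_filter.2 ⟨mem_powerset.2 (insert_subset hA hJA), ?_⟩
    rw [card_insert_of_notMem hAJ]
    calc _ ≤ ((J.inf id)ᶜ.card + (monoColorings (forced (J.inf id) A)).card) * 2 ^ k := by
          gcongr
          omega
      _ ≤ _ := by linarith
  have := hmax _ this
  rw [card_insert_of_notMem hAJ] at this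
  omega

/-- For few pairs of sets of two-colourings there is a triangle whose semi-filter, generated by its
three edges on a suitable set `U` of colourings, is proper and preserves all pairs. -/
theorem exists_triangle_preserving (Q : Finset (Finset (α → Bool) × Finset (α → Bool))) (k : ℕ)
    (hk : 4 * Q.card < 2 ^ k)
    (hn : Q.card * ((2 * k) ^ 2 * (2 * k) ^ 2) < (Fintype.card α).choose 3) :
    ∃ T : Finset α, T.card = 3 ∧ ∃ U : Finset (α → Bool),
      (∀ e : Finset α, e.card = 2 → ∃ χ ∈ U, ¬ IsMono χ e) ∧
      ∀ P ∈ Q, (∃ e ⊆ T, e ∈ forced U P.1) → (∃ e ⊆ T, e ∈ forced U P.2) →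
        ∃ e ⊆ T, e ∈ forced U (P.1 ∩ P.2) := by
  obtain ⟨U, hUc, hU⟩ := exists_large_closed (Q.image Prod.fst ∪ Q.image Prod.snd) k
  have hcard : (Q.image Prod.fst ∪ Q.image Prod.snd).card ≤ 2 * Q.card := by
    have h1 := card_union_le (Q.image Prod.fst) (Q.image Prod.snd)
    have h2 : (Q.image Prod.fst).card ≤ Q.card := card_image_le
    have h3 : (Q.image Prod.snd).card ≤ Q.card := card_image_le
    omega
  let bad : Finset (Finset α) := Q.biUnion fun P =>
    if (forced U P.1).card < (2 * k) ^ 2 ∧ (forced U P.2).card < (2 * k) ^ 2 then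
      (forced U P.1 ×ˢ forced U P.2).image fun q => q.1 ∪ q.2 else ∅
  have hbad : bad.card ≤ Q.card * ((2 * k) ^ 2 * (2 * k) ^ 2) := by
    refine card_biUnion_le_card_mul _ _ _ fun P _ => ?_
    split_ifs with h
    · refine card_image_le.trans ?_
      rw [card_product]
      exact Nat.mul_le_mul h.1.le h.2.le
    · simp
  obtain ⟨T, hT, hTbad⟩ : ∃ T ∈ powersetCard 3 (univ : Finset α), T ∉ bad :=
    exists_mem_notMem_of_card_lt_card (by simpa using hbad.trans_lt hn)
  have hT3 : T.card = 3 := (mem_powersetCard.1 hT).2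
  refine ⟨T, hT3, U, fun e he => ?_, ?_⟩
  -- `U` holds more than half of all colourings, whereas only half are constant on a given edge.
  · by_contra! hall
    obtain ⟨a, b, hab, rfl⟩ := card_eq_two.1 he
    have h1 := two_mul_card_monoColorings_insert_le (L := ∅) (X := ∅) (e := {a, b}) (a := a)
      (b := b) (by simp) (by simp) (by simp) hab (by simp)
    rw [card_monoColorings_empty] at h1
    have h2 : U.card ≤ (monoColorings (insert {a, b} ∅)).card :=
      card_le_card fun χ hχ => mem_monoColorings.2 (by simpa using hall χ hχ)
    have h3 : U.card + Uᶜ.card = 2 ^ Fintype.card α := by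
      rw [card_add_card_compl]; simp
    have h4 : 2 ^ Fintype.card α ≤ 2 * Uᶜ.card := by omega
    have h5 : 2 ^ Fintype.card α * 2 ^ k ≤ 2 ^ Fintype.card α * (4 * Q.card) :=
      calc _ ≤ 2 * Uᶜ.card * 2 ^ k := by gcongr
        _ = 2 * (Uᶜ.card * 2 ^ k) := by ring
        _ ≤ 2 * (2 * Q.card * 2 ^ Fintype.card α) := by exact Nat.mul_le_mul_left 2 (hUc.trans (by gcongr))
        _ = _ := by ring
    exact absurd (Nat.le_of_mul_le_mul_left h5 (by positivity)) (by omega)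
  · rintro P hP ⟨e, heT, he⟩ ⟨e', heT', he'⟩
    obtain ⟨hec, heA⟩ := mem_forced.1 he
    obtain ⟨hec', heA'⟩ := mem_forced.1 he'
    rcases hU P.1 (mem_union_left _ (mem_image_of_mem _ hP)) with h1 | h1
    · exact ⟨e', heT', mem_forced.2 ⟨hec', fun χ hχ hm => mem_inter.2 ⟨h1 hχ, heA' χ hχ hm⟩⟩⟩
    rcases hU P.2 (mem_union_right _ (mem_image_of_mem _ hP)) with h2 | h2
    · exact ⟨e, heT, mem_forced.2 ⟨hec, fun χ hχ hm => mem_inter.2 ⟨heA χ hχ hm, h2 hχ⟩⟩⟩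
    by_cases hee : e = e'
    · subst hee
      exact ⟨e, heT, mem_forced.2
        ⟨hec, fun χ hχ hm => mem_inter.2 ⟨heA χ hχ hm, heA' χ hχ hm⟩⟩⟩
    · refine absurd ?_ hTbad
      refine mem_biUnion.2 ⟨P, hP, ?_⟩
      rw [if_pos ⟨h1, h2⟩]
      refine mem_image.2 ⟨(e, e'), mem_product.2 ⟨he, he'⟩, ?_⟩
      refine eq_of_subset_of_card_le (union_subset heT heT') ?_
      have hss : e ⊂ e ∪ e' := by
        refine Finset.ssubset_iff_subset_ne.2 ⟨subset_union_left, fun h => hee ?_⟩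
        have : e' ⊆ e := h ▸ subset_union_right
        exact (eq_of_subset_of_card_le this (by omega)).symm
      have := card_lt_card hss
      change T.card ≤ (e ∪ e').card
      omega

end Colorings

/-! ### Limits of cyclic evaluations -/

namespace SyntacticSequence

variable {Γ : Type*} {B : Set (Set Γ)} (S : SyntacticSequence B)

lemma stage_mono (i : Fin S.len) : Monotone fun j => S.stage j i :=
  monotone_nat_of_le_succ fun _ => Set.subset_union_left

/-- The sets of the entries in the limit of the evaluation. -/
def limit (i : Fin S.len) : Set Γ := ⋃ j, S.stage j i

lemma operand_mono {v w : Fin S.len → Set Γ} (h : ∀ i, v i ⊆ w i) (o : Fin S.len ⊕ B) :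
    S.operand v o ⊆ S.operand w o := by
  cases o with
  | inl i => exact h i
  | inr b => exact subset_rfl

lemma operand_limit (o : Fin S.len ⊕ B) {x : Γ} (hx : x ∈ S.operand S.limit o) :
    ∃ j, x ∈ S.operand (S.stage j) o := by
  cases o with
  | inl i => exact Set.mem_iUnion.1 hx
  | inr b => exact ⟨0, hx⟩

lemma apply_limit_subset (i : Fin S.len) :
    (S.op i).apply (S.operand S.limit (S.left i)) (S.operand S.limit (S.right i)) ⊆
      S.limit i := by
  intro x hx
  suffices h : ∃ j, x ∈ (S.op i).apply (S.operand (S.stage j) (S.left i))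
      (S.operand (S.stage j) (S.right i)) by
    obtain ⟨j, hj⟩ := h
    exact Set.mem_iUnion.2 ⟨j + 1, Or.inr hj⟩
  cases hop : S.op i with
  | inter =>
    rw [hop] at hx
    obtain ⟨j₁, h₁⟩ := S.operand_limit _ hx.1
    obtain ⟨j₂, h₂⟩ := S.operand_limit _ hx.2
    exact ⟨max j₁ j₂, S.operand_mono (fun i => S.stage_mono i (le_max_left _ _)) _ h₁,
      S.operand_mono (fun i => S.stage_mono i (le_max_right _ _)) _ h₂⟩
  | union =>
    rw [hop] at hx
    rcases hx with hx | hx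
    · obtain ⟨j, h⟩ := S.operand_limit _ hx
      exact ⟨j, Or.inl h⟩
    · obtain ⟨j, h⟩ := S.operand_limit _ hx
      exact ⟨j, Or.inr h⟩

lemma limit_last_of_generates {A : Set Γ} (h : S.Generates A) : S.limit S.last = A := by
  obtain ⟨j, hj⟩ := h
  apply subset_antisymm
  · refine Set.iUnion_subset fun j' => ?_
    rw [← hj (max j j') (le_max_left _ _)]
    exact S.stage_mono _ (le_max_right _ _)
  · rw [← hj j le_rfl]
    exact Set.subset_iUnion (fun j => S.stage j S.last) j

/-- An upward closed family that contains the generators containing `w` and preserves the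
intersections of the sequence contains every entry of the sequence that contains `w`. -/
theorem limit_mem_of_mem {w : Γ} (F : Set Γ → Prop) (hup : ∀ X Y, X ⊆ Y → F X → F Y)
    (hB : ∀ b ∈ B, w ∈ b → F b)
    (hinter : ∀ i, S.op i = SetOp.inter → F (S.operand S.limit (S.left i)) →
      F (S.operand S.limit (S.right i)) →
      F (S.operand S.limit (S.left i) ∩ S.operand S.limit (S.right i)))
    (i : Fin S.len) (hw : w ∈ S.limit i) : F (S.limit i) := by
  -- The induction is on the stage at which `w` enters, while `F` is tested on limit sets; hence
  -- cycles do no harm.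
  obtain ⟨j, hj⟩ := Set.mem_iUnion.1 hw
  clear hw
  induction j generalizing i with
  | zero => exact hj.elim
  | succ j ih =>
    have hop : ∀ o, w ∈ S.operand (S.stage j) o → F (S.operand S.limit o) := by
      intro o ho
      cases o with
      | inl i => exact ih i ho
      | inr b => exact hB b.1 b.2 ho
    rcases hj with hj | hj
    · exact ih i hj
    · refine hup _ _ (S.apply_limit_subset i) ?_
      cases h : S.op i with
      | inter =>
        rw [h] at hj
        exact hinter i h (hop _ hj.1) (hop _ hj.2)
      | union =>
        rw [h] at hj
        rcases hj with hj | hj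
        · exact hup _ _ Set.subset_union_left (hop _ hj)
        · exact hup _ _ Set.subset_union_right (hop _ hj)

end SyntacticSequence

/-! ### Cuts, cliques and the gate bound -/

section Inputs

variable {n : ℕ}

open Classical in
/-- The complete bipartite graph between the two classes of a colouring. -/
noncomputable def cutInput (χ : Fin n → Bool) : EdgeVar n → Bool :=
  fun e => decide (∃ x ∈ e.1, ∃ y ∈ e.1, χ x ≠ χ y)

open Classical in
/-- The complete graph on a set of vertices. -/
noncomputable def cliqueInput (T : Finset (Fin n)) : EdgeVar n → Bool :=
  fun e => decide (∀ x ∈ e.1, x ∈ T)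

lemma kClique_cliqueInput {T : Finset (Fin n)} {k : ℕ} (hT : T.card = k) :
    kClique k n (cliqueInput T) = true := by
  simp only [kClique, decide_eq_true_eq]
  refine ⟨T, ?_, hT⟩
  intro a ha b hb hab
  refine (SimpleGraph.fromEdgeSet_adj _).2 ⟨⟨by simpa using hab, ?_⟩, hab⟩
  simp only [cliqueInput, decide_eq_true_eq]
  intro x hx
  rcases Sym2.mem_iff.1 hx with rfl | rfl
  · exact ha
  · exact hb

lemma kClique_three_cutInput (χ : Fin n → Bool) : kClique 3 n (cutInput χ) = false := by
  simp only [kClique, decide_eq_false_iff_not]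
  rintro ⟨s, hs⟩
  have hadj : ∀ a b, (inputGraph (cutInput χ)).Adj a b → χ a ≠ χ b := by
    intro a b h
    obtain ⟨⟨_, h⟩, -⟩ := (SimpleGraph.fromEdgeSet_adj _).1 h
    simp only [cutInput, decide_eq_true_eq] at h
    obtain ⟨x, hx, y, hy, hxy⟩ := h
    rcases Sym2.mem_iff.1 hx with rfl | rfl <;> rcases Sym2.mem_iff.1 hy with rfl | rfl
    · exact absurd rfl hxy
    · exact hxy
    · exact hxy.symm
    · exact absurd rfl hxy
  obtain ⟨a, b, c, hab, hac, hbc, -⟩ := SimpleGraph.is3Clique_iff.1 hs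
  have h1 := hadj _ _ hab
  have h2 := hadj _ _ hac
  have h3 := hadj _ _ hbc
  revert h1 h2 h3
  cases χ a <;> cases χ b <;> cases χ c <;> simp

open Classical in
/-- The colourings whose cut lies in a given set of inputs. -/
noncomputable def cutColorings (X : Set (EdgeVar n → Bool)) : Finset (Fin n → Bool) :=
  Finset.univ.filter fun χ => cutInput χ ∈ X

lemma mem_cutColorings {X : Set (EdgeVar n → Bool)} {χ : Fin n → Bool} :
    χ ∈ cutColorings X ↔ cutInput χ ∈ X := by
  simp [cutColorings]

lemma cutColorings_inter (X Y : Set (EdgeVar n → Bool)) :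
    cutColorings (X ∩ Y) = cutColorings X ∩ cutColorings Y := by
  ext χ
  simp [mem_cutColorings]

/-- A cyclic circuit for triangles with fewer than `2 ^ k / 4` AND gates has at least
`n.choose 3 / (2 * k) ^ 4` of them. -/
theorem choose_three_le_andCount_mul (C : MonotoneCyclicCircuit (EdgeVar n))
    (hC : C.Computes (kClique 3 n)) (k : ℕ) (hk : 4 * C.andCount < 2 ^ k) :
    n.choose 3 ≤ C.andCount * ((2 * k) ^ 2 * (2 * k) ^ 2) := by
  classical
  by_contra! hlt
  let pr : Fin C.len → Finset (Fin n → Bool) × Finset (Fin n → Bool) := fun i =>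
    (cutColorings (C.operand C.limit (C.left i)), cutColorings (C.operand C.limit (C.right i)))
  let Q := (Finset.univ.filter fun i => C.op i = SetOp.inter).image pr
  have hcard : Q.card ≤ C.andCount := by
    refine Finset.card_image_le.trans (le_of_eq ?_)
    rw [MonotoneCyclicCircuit.andCount, SyntacticSequence.interCount, ← Set.ncard_coe_finset]
    simp
  obtain ⟨T, hT, U, hU, hpres⟩ := exists_triangle_preserving Q k (by omega)
    ((Nat.mul_le_mul_right _ hcard).trans_lt (by simpa using hlt))
  have hw : cliqueInput T ∈ C.limit C.last := by
    rw [C.limit_last_of_generates hC]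
    exact kClique_cliqueInput hT
  have hF := C.limit_mem_of_mem (w := cliqueInput T)
    (fun X => ∃ e ⊆ T, e ∈ forced U (cutColorings X)) ?_ ?_ ?_ C.last hw
  · obtain ⟨e, -, he⟩ := hF
    obtain ⟨hec, heA⟩ := mem_forced.1 he
    obtain ⟨χ, hχ, hm⟩ := hU e hec
    have := mem_cutColorings.1 (heA χ hχ hm)
    rw [C.limit_last_of_generates hC] at this
    simp [kClique_three_cutInput] at this
  · rintro X Y hXY ⟨e, heT, he⟩
    obtain ⟨hec, heA⟩ := mem_forced.1 he
    exact ⟨e, heT, mem_forced.2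
      ⟨hec, fun χ hχ hm => mem_cutColorings.2 (hXY (mem_cutColorings.1 (heA χ hχ hm)))⟩⟩
  -- An edge variable true on `T` is forced by its own edge, since any colouring splitting that edge
  -- has it in its cut.
  · rintro b (⟨⟨e, hdiag⟩, rfl⟩ | hb) hwb
    · induction e using Sym2.ind with
      | _ x y =>
        simp only [cliqueInput, Set.mem_ofPred_eq, decide_eq_true_eq] at hwb
        have hxy : x ≠ y := by simpa using hdiag
        refine ⟨{x, y}, ?_, mem_forced.2 ⟨Finset.card_pair hxy, fun χ _ hm => ?_⟩⟩
        · intro z hz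
          exact hwb z (by simpa [Sym2.mem_iff] using hz)
        · rw [mem_cutColorings]
          simp only [IsMono, not_forall] at hm
          obtain ⟨u, hu, v, hv, huv⟩ := hm
          simp only [cutInput, Set.mem_ofPred_eq, decide_eq_true_eq]
          exact ⟨u, by simpa [Sym2.mem_iff] using hu, v, by simpa [Sym2.mem_iff] using hv, huv⟩
    · rcases hb with rfl | rfl
      · exact hwb.elim
      · obtain ⟨e, heT, hec⟩ := Finset.exists_subset_card_eq (s := T) (n := 2) (by omega)
        exact ⟨e, heT, mem_forced.2 ⟨hec, fun χ _ _ => mem_cutColorings.2 trivial⟩⟩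
  · intro i hi h1 h2
    rw [cutColorings_inter]
    exact hpres (pr i) (Finset.mem_image_of_mem _ (by simpa using hi)) h1 h2

end Inputs

/-- The constant is attained at `n = 3`. -/
lemma cube_le_choose_three {n : ℕ} (hn : 3 ≤ n) : n ^ 3 ≤ 27 * n.choose 3 := by
  obtain ⟨m, rfl⟩ := Nat.exists_eq_add_of_le' hn
  have h : (m + 3).choose 3 * 6 = (m + 3) * (m + 2) * (m + 1) := by
    have := Nat.descFactorial_eq_factorial_mul_choose (m + 3) 3
    simp [Nat.descFactorial_succ, Nat.factorial] at this
    linarith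
  nlinarith [sq_nonneg m, Nat.zero_le (m ^ 3)]

end CyclicCircuit

/-- Every monotone cyclic Boolean circuit computing `3`-clique on `n`-vertex graphs has
`Ω(n ^ 3 / (log n) ^ 4)` fan-in two AND gates. -/
theorem mainTheorem9 :
    ∃ c : ℝ, 0 < c ∧ ∃ n₀ : ℕ, ∀ n : ℕ, n₀ ≤ n →
      ∀ C : CyclicCircuit.MonotoneCyclicCircuit (CyclicCircuit.EdgeVar n),
        CyclicCircuit.MonotoneCyclicCircuit.Computes C (CyclicCircuit.kClique 3 n) →
          c * ((n : ℝ) ^ 3 / (Real.log n) ^ 4) ≤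
            (CyclicCircuit.MonotoneCyclicCircuit.andCount C : ℝ) := by
  -- `4320000 = 27 * 2 ^ 4 * 10 ^ 4`, from `n ^ 3 ≤ 27 * n.choose 3` and `k = 3 * L + 5 ≤ 10 *
  -- Real.log n`; `n ≥ 3` gives `Real.log n ≥ 1`.
  refine ⟨1 / 4320000, by norm_num, 3, fun n hn C hC => ?_⟩
  have hn3 : (3 : ℝ) ≤ n := by exact_mod_cast hn
  have hlog : 1 ≤ Real.log n := by
    rw [Real.le_log_iff_exp_le (by linarith)]
    linarith [Real.exp_one_lt_d9]
  have hlog4 : 1 ≤ Real.log n ^ 4 := one_le_pow₀ hlog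
  rw [← mul_div_assoc, div_le_iff₀ (by positivity)]
  -- With at least `n ^ 3` AND gates nothing is left to prove; with fewer, a logarithmic `k` is
  -- admissible.
  rcases le_or_gt (n ^ 3) C.andCount with hbig | hsmall
  · have h : (n : ℝ) ^ 3 ≤ C.andCount := by exact_mod_cast hbig
    have h0 : (0 : ℝ) ≤ (n : ℝ) ^ 3 := by positivity
    nlinarith
  · set L := Nat.log 2 n
    have hpow : n < 2 ^ (L + 1) := Nat.lt_pow_succ_log_self (by norm_num) n
    have hk : 4 * C.andCount < 2 ^ (3 * L + 5) := by
      have : n ^ 3 < (2 ^ (L + 1)) ^ 3 := Nat.pow_lt_pow_left hpow (by norm_num)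
      have e : 2 ^ (3 * L + 5) = 4 * (2 ^ (L + 1)) ^ 3 := by ring
      omega
    have h1 := CyclicCircuit.choose_three_le_andCount_mul C hC _ hk
    have h2 := CyclicCircuit.cube_le_choose_three hn
    have hL : ((3 * L + 5 : ℕ) : ℝ) ≤ 10 * Real.log n := by
      have h : (L : ℝ) * Real.log 2 ≤ Real.log n := by
        rw [← Real.log_pow]
        refine Real.log_le_log (by positivity) ?_
        exact_mod_cast Nat.pow_log_le_self 2 (by omega)
      have := Real.log_two_gt_d9
      have hL0 : (0 : ℝ) ≤ L := Nat.cast_nonneg _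
      push_cast
      nlinarith
    have h3 : (n : ℝ) ^ 3 ≤
        27 * (C.andCount * ((2 * ((3 * L + 5 : ℕ) : ℝ)) ^ 2 * (2 * ((3 * L + 5 : ℕ) : ℝ)) ^ 2)) := by
      exact_mod_cast h2.trans (Nat.mul_le_mul_left 27 h1)
    have h4 : ((3 * L + 5 : ℕ) : ℝ) ^ 4 ≤ (10 * Real.log n) ^ 4 := by gcongr
    have h5 := mul_le_mul_of_nonneg_left h4 (Nat.cast_nonneg (α := ℝ) C.andCount)
    nlinarith
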